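/- Let $\mathcal{C}=\mathbb{Q}[\hbar]$, and let $\mathfrak{h}^1$ be the non-commutative polynomial algebra over $\mathcal{C}$ freely generated by letters $z_1,z_2,z_3,\dots$. Let $\mathfrak{h}^1_{>0}$ be the $\mathcal{C}$-submodule spanned by the non-empty words, and $\mathfrak{h}^0$ the $\mathcal{C}$-submodule spanned by $1$ and the words $z_{k_1}\cdots z_{k_r}$ with $r\ge 1$, $k_1\ge 2$. Define the following. - $\phi:\mathfrak{h}^1\to\mathfrak{h}^1$ is the $\mathcal{C}$-linear map with $\phi(1)=1$ and, for a word $u=z_{k_1}\cdots z_{k_r}$ ($r\ge1$), $\phi(u)=z_{p_1}z_{p_2-p_1}\cdots z_{p_l-p_{l-1}}$, where $p_1<\cdots<p_l$ are the elements of $\{1,\dots,k_1+\cdots+k_r\}\setminus\{k_1+\cdots+k_j \mid 1\le j<r\}$. - $*_{\pm}$ are the $\mathcal{C}$-bilinear products on $\mathfrak{h}^1$ with $1*_\pm w=w*_\pm 1=w$ and $$(z_iw_1)*_\pm(z_jw_2)=z_i(w_1*_\pm z_jw_2)+z_j(z_iw_1*_\pm w_2)+(\pm z_{i+j}+\hbar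 z_{i+j-1})(w_1*_\pm w_2)$$ for $i,j\ge1$ and $w,w_1,w_2\in\mathfrak{h}^1$. - For $i\ge 1$, $w\mapsto z_i\circ_+ w$ is the $\mathcal{C}$-linear map on $\mathfrak{h}^1$ with $z_i\circ_+1=0$ and $z_i\circ_+(z_jw)=(z_{i+j}+\hbar z_{i+j-1})w$; and $d_q:\mathfrak{h}^1\to\mathfrak{h}^1$ is the $\mathcal{C}$-linear map with $d_q(1)=1$ and $d_q(z_iw)=z_i\,d_q(w)+z_i\circ_+d_q(w)$. - $\circledast_q$ is the $\mathcal{C}$-bilinear product on $\mathfrak{h}^1_{>0}$ with $(z_iw_1)\circledast_q(z_jw_2)=z_{i+j}(w_1*_+w_2)$ for $i,j\ge1$, $w_1,w_2\in\mathfrak{h}^1$. Its values lie in $\mathfrak{h}^0$. - The ring $\mathbb{Q}[[q]]$, with its $q$-adic topology, is a $\mathcal{C}$-module on which $\hbar$ acts as multiplication by $1-q$. With $[m]=(1-q^m)/(1-q)$, the $q$-analogue of the multiple zeta value is the $\mathcal{C}$-linear map $\zeta_q:\mathfrak{h}^0\to\mathbb{Q}[[q]]$ with $\zeta_q(1)=1$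 and $$\zeta_q(z_{k_1}\cdots z_{k_r})=\sum_{m_1>\cdots>m_r>0}\frac{q^{(k_1-1)m_1+\cdots+(k_r-1)m_r}}{[m_1]^{k_1}\cdots[m_r]^{k_r}},$$ that is, $\zeta_q(w)=\lim_{n\to\infty}A_w(n)$, where $A_w(n)$ is the $\mathcal{C}$-linear extension of the truncations of these sums to $m_1\le n$. Then for all $w_1,w_2\in\mathfrak{h}^1_{>0}$ and every integer $n\ge1$, $$\zeta_q\bigl(d_q(\phi(w_1*_-w_2))\circledast_q z_1^n\bigr)+\sum_{\substack{k+l=n\\ k,l\ge1}}\zeta_q\bigl(d_q(\phi(w_1))\circledast_q z_1^k\bigr)\,\zeta_q\bigl(d_q(\phi(w_2))\circledast_q z_1^l\bigr)=0$$ in $\mathbb{Q}[[q]]$. -/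

import Mathlib

namespace QMZV

/-! ### The algebra of words -/

/-- The coefficient ring `𝒞 = ℚ[ħ]`. -/
abbrev C : Type := Polynomial ℚ

/-- The formal variable `ħ`. -/
noncomputable abbrev hbar : C := Polynomial.X

/-- `𝔥¹`: the non-commutative polynomial algebra over `𝒞` freely generated by the letters `z_i`,
`i ≥ 1`. -/
abbrev H1 : Type := FreeAlgebra C ℕ+

/-- The letter `z_i`. -/
noncomputable def z (i : ℕ+) : H1 := FreeAlgebra.ι C i

/-- The word `z_{k_1} ⋯ z_{k_r}` attached to `(k_1, …, k_r)`; the empty list gives `1`. -/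
noncomputable def word (u : List ℕ+) : H1 := (u.map z).prod

/-- The words form a `𝒞`-basis of `𝔥¹` (see `wordBasis_apply`). -/
noncomputable def wordBasis : Module.Basis (List ℕ+) C H1 :=
  (FreeAlgebra.basisFreeMonoid C ℕ+).reindex FreeMonoid.toList

theorem wordBasis_apply (u : List ℕ+) : wordBasis u = word u := by
  simp only [wordBasis, word, FreeAlgebra.basisFreeMonoid, Module.Basis.reindex_apply,
    Module.Basis.map_apply]
  simp [FreeAlgebra.equivMonoidAlgebraFreeMonoid, FreeMonoid.lift_apply]
  rfl

/-- The `𝒞`-linear extension of a map defined on words. -/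
noncomputable def linExt {M : Type} [AddCommGroup M] [Module C M] (f : List ℕ+ → M) :
    H1 →ₗ[C] M :=
  wordBasis.constr C f

theorem linExt_word {M : Type} [AddCommGroup M] [Module C M] (f : List ℕ+ → M) (u : List ℕ+) :
    linExt f (word u) = f u := by
  rw [← wordBasis_apply, linExt, Module.Basis.constr_basis]

/-- `𝔥¹_{>0}`: the `𝒞`-submodule spanned by the non-empty words. -/
noncomputable def H1pos : Submodule C H1 :=
  Submodule.span C {x | ∃ u : List ℕ+, u ≠ [] ∧ x = word u}

/-- `𝔥⁰`: the `𝒞`-submodule spanned by `1` and the words `z_{k_1} ⋯ z_{k_r}` with `r ≥ 1` and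
`k_1 ≥ 2`. -/
noncomputable def H0 : Submodule C H1 :=
  Submodule.span C ({1} ∪ {x | ∃ (k : ℕ+) (u : List ℕ+), 2 ≤ k ∧ x = word (k :: u)})

/-! ### The duality map `φ` -/

/-- `∑ k_i`, as a natural number. -/
def weight (u : List ℕ+) : ℕ := (u.map fun k => (k : ℕ)).sum

/-- `I_u = {k_1 + ⋯ + k_j | 1 ≤ j < r}`. -/
def partialSums (u : List ℕ+) : Finset ℕ :=
  (Finset.Ico 1 u.length).image fun j => weight (u.take j)

/-- The increasing list of the elements of `I_u^c = {1, …, k_1 + ⋯ + k_r} ∖ I_u`. -/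
def complList (u : List ℕ+) : List ℕ :=
  (List.range' 1 (weight u)).filter fun p => p ∉ partialSums u

/-- `(p_1, p_2, …, p_l) ↦ (p_1 - a, p_2 - p_1, …, p_l - p_{l-1})` for `a < p_1 < ⋯ < p_l`. -/
def gaps : ℕ → List ℕ → List ℕ+
  | _, [] => []
  | a, p :: l => (p - a).toPNat' :: gaps p l

/-- `φ` on words, as an operation on the lists of indices. -/
def phiWord (u : List ℕ+) : List ℕ+ := gaps 0 (complList u)

/-- The `𝒞`-linear map `φ : 𝔥¹ → 𝔥¹`. -/
noncomputable def phi : H1 →ₗ[C] H1 := linExt fun u => word (phiWord u)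

/-! ### Products -/

/-- `s z_{i+j} + ħ z_{i+j-1}`; this is `z_i ∘_+ z_j` for `s = 1` and `z_i ∘_- z_j` for `s = -1`. -/
noncomputable def letterProd (s : C) (i j : ℕ+) : H1 := s • z (i + j) + hbar • z (i + j - 1)

/-- The harmonic product of two words attached to `letterProd s`. -/
noncomputable def harmonicWord (s : C) : List ℕ+ → List ℕ+ → H1
  | [], v => word v
  | i :: u, [] => word (i :: u)
  | i :: u, j :: v =>
      z i * harmonicWord s u (j :: v) + z j * harmonicWord s (i :: u) v
        + letterProd s i j * harmonicWord s u v
  termination_by u v => u.length + v.length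

/-- The `𝒞`-bilinear harmonic product on `𝔥¹` attached to `letterProd s`. -/
noncomputable def harmonicProd (s : C) : H1 →ₗ[C] H1 →ₗ[C] H1 :=
  linExt fun u => linExt fun v => harmonicWord s u v

/-- The product `*_+`. -/
noncomputable def harmonicPlus : H1 →ₗ[C] H1 →ₗ[C] H1 := harmonicProd 1

/-- The product `*_-`. -/
noncomputable def harmonicMinus : H1 →ₗ[C] H1 →ₗ[C] H1 := harmonicProd (-1)

/-- The action `w ↦ z_i ∘_+ w` on `𝔥¹`: `z_i ∘_+ 1 = 0` and
`z_i ∘_+ (z_j w) = (z_i ∘_+ z_j) w`. -/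
noncomputable def circPlus (i : ℕ+) : H1 →ₗ[C] H1 :=
  linExt fun
    | [] => 0
    | j :: v => letterProd 1 i j * word v

/-- `d_q` on words. -/
noncomputable def dqWord : List ℕ+ → H1
  | [] => 1
  | i :: u => z i * dqWord u + circPlus i (dqWord u)

/-- The `𝒞`-linear map `d_q : 𝔥¹ → 𝔥¹`. -/
noncomputable def dq : H1 →ₗ[C] H1 := linExt dqWord

/-- `⊛_q` on words: `(z_i u) ⊛_q (z_j v) = z_{i+j} (u *_+ v)`. The product is only meant for
`𝔥¹_{>0}`; it is set to `0` when one of the words is empty. -/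
noncomputable def circledastWord : List ℕ+ → List ℕ+ → H1
  | i :: u, j :: v => z (i + j) * harmonicPlus (word u) (word v)
  | _, _ => 0

/-- The `𝒞`-bilinear product `⊛_q` on `𝔥¹_{>0}` (extended by `0` to the constants). -/
noncomputable def circledast : H1 →ₗ[C] H1 →ₗ[C] H1 :=
  linExt fun u => linExt fun v => circledastWord u v

/-! ### `q`-series -/

/-- `ℛ = ℚ⟦q⟧`. -/
abbrev R : Type := PowerSeries ℚ

/-- The formal variable `q`. -/
noncomputable abbrev q : R := PowerSeries.X

/-- The `𝒞`-algebra structure of `ℛ`: `ħ` acts as multiplication by `1 - q`. (It is not registered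
as an instance, since Mathlib lets the variable of `ℚ[X]` act on `ℚ⟦X⟧` by `X`.) -/
noncomputable def coeffHom : C →+* R := (Polynomial.aeval (1 - q)).toRingHom

/-- The `q`-integer `[m] = (1 - q^m) / (1 - q)`. -/
noncomputable def qInt (m : ℕ) : R := (1 - q ^ m) * (1 - q)⁻¹

/-- The finite multiple harmonic `q`-series
`A_u(n) = ∑_{n ≥ m_1 > ⋯ > m_r > 0} ∏_i q^{(k_i - 1) m_i} / [m_i]^{k_i}`,
as an iterated sum (the index `m` below stands for `m_1 - 1`). -/
noncomputable def AWord : List ℕ+ → ℕ → R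
  | [], _ => 1
  | k :: u, n =>
      ∑ m ∈ Finset.range n,
        q ^ (((k : ℕ) - 1) * (m + 1)) * (qInt (m + 1) ^ (k : ℕ))⁻¹ * AWord u m

/-- The `𝒞`-linear extension `w ↦ A_w` to `𝔥¹`. -/
noncomputable def A (w : H1) (n : ℕ) : R :=
  (wordBasis.repr w).sum fun u c => coeffHom c * AWord u n

/-- The `q`-adic topology on `ℛ`. -/
noncomputable abbrev qAdic : TopologicalSpace R := (Ideal.span {q}).adicTopology

/-- The `q`-analogue of the multiple zeta value, `ζ_q(w) = lim_{n → ∞} A_w(n)` in the `q`-adic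
topology. It is meant for `w ∈ 𝔥⁰`, where the limit exists (see `tendsto_zetaQ`). -/
noncomputable def zetaQ (w : H1) : R := @Filter.limUnder R qAdic ℕ _ Filter.atTop (A w)

theorem coeff_AWord_stable (k : ℕ+) (hk : 2 ≤ k) (u : List ℕ+) (N n : ℕ) (hn : N ≤ n) :
    q ^ N ∣ AWord (k :: u) n - AWord (k :: u) N := by
  induction n, hn using Nat.le_induction with
  | base => simp
  | succ n hn ih =>
    have h : AWord (k :: u) (n + 1) - AWord (k :: u) N =
        (AWord (k :: u) n - AWord (k :: u) N) +
        q ^ (((k : ℕ) - 1) * (n + 1)) * (qInt (n + 1) ^ (k : ℕ))⁻¹ * AWord u n := by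
      simp only [AWord, Finset.sum_range_succ]
      ring
    rw [h]
    refine dvd_add ih (Dvd.dvd.mul_right (Dvd.dvd.mul_right (pow_dvd_pow _ ?_) _) _)
    have h2 : 2 ≤ (k : ℕ) := by exact_mod_cast hk
    have h1 : 1 ≤ (k : ℕ) - 1 := by omega
    nlinarith

theorem A_add (x y : H1) (n : ℕ) : A (x + y) n = A x n + A y n := by
  unfold A
  rw [map_add, Finsupp.sum_add_index' (by simp) (by intros; simp [add_mul])]

theorem A_smul (c : C) (x : H1) (n : ℕ) : A (c • x) n = coeffHom c * A x n := by
  unfold A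
  rw [map_smul, Finsupp.sum_smul_index (by simp), Finsupp.mul_sum]
  simp [mul_assoc]

theorem A_word (u : List ℕ+) (n : ℕ) : A (word u) n = AWord u n := by
  unfold A
  rw [← wordBasis_apply, Module.Basis.repr_self, Finsupp.sum_single_index] <;> simp

theorem A_stable (w : H1) (hw : w ∈ H0) (N n : ℕ) (hn : N ≤ n) : q ^ N ∣ A w n - A w N := by
  unfold H0 at hw
  induction hw using Submodule.span_induction with
  | mem x hx =>
    rcases hx with hx | ⟨k, u, hk, rfl⟩
    · have : x = word [] := by simpa [word] using hx
      subst this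
      simp [A_word, AWord]
    · rw [A_word, A_word]
      exact coeff_AWord_stable k hk u N n hn
  | zero => simp [A]
  | add x y _ _ hx hy =>
    rw [A_add, A_add, add_sub_add_comm]
    exact dvd_add hx hy
  | smul c x _ hx =>
    rw [A_smul, A_smul, ← mul_sub]
    exact Dvd.dvd.mul_left hx _

/-- The limit which defines `ζ_q(w)` exists for `w ∈ 𝔥⁰`. -/
theorem tendsto_zetaQ (w : H1) (hw : w ∈ H0) :
    Filter.Tendsto (A w) Filter.atTop (@nhds R qAdic (zetaQ w)) := by
  let _ := qAdic
  refine _root_.tendsto_nhds_limUnder ⟨PowerSeries.mk fun N => PowerSeries.coeff N (A w (N + 1)), ?_⟩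
  rw [((Ideal.span {q}).hasBasis_nhds_adic _).tendsto_right_iff]
  intro N _
  filter_upwards [Filter.eventually_ge_atTop N] with n hn
  refine ⟨A w n - PowerSeries.mk fun N => PowerSeries.coeff N (A w (N + 1)), ?_, by simp⟩
  rw [Ideal.span_singleton_pow, SetLike.mem_coe, Ideal.mem_span_singleton,
    PowerSeries.X_pow_dvd_iff]
  intro m hm
  have h := A_stable w hw (m + 1) n (by omega)
  rw [PowerSeries.X_pow_dvd_iff] at h
  simpa using h m (Nat.lt_succ_self m)

/-- Left multiplication by a letter `z_k` with `k ≥ 2` maps `𝔥¹` to `𝔥⁰`. -/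
theorem z_mul_mem_H0 (k : ℕ+) (hk : 2 ≤ k) (x : H1) : z k * x ∈ H0 := by
  rw [← wordBasis.linearCombination_repr x, Finsupp.linearCombination_apply, Finsupp.sum,
    Finset.mul_sum]
  refine Submodule.sum_mem _ fun u _ => ?_
  rw [mul_smul_comm]
  refine Submodule.smul_mem _ _ (Submodule.subset_span (Or.inr ⟨k, u, hk, ?_⟩))
  rw [wordBasis_apply]
  simp [word]

/-- `⊛_q` takes values in `𝔥⁰`. -/
theorem circledast_mem_H0 (x y : H1) : circledast x y ∈ H0 := by
  have key : ∀ u v : List ℕ+, circledastWord u v ∈ H0 := by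
    intro u v
    rcases u with _ | ⟨i, u⟩ <;> rcases v with _ | ⟨j, v⟩ <;>
      simp only [circledastWord, Submodule.zero_mem]
    exact z_mul_mem_H0 _ (by
      rw [← PNat.coe_le_coe]
      have := i.pos
      have := j.pos
      push_cast
      omega) _
  rw [← wordBasis.linearCombination_repr x, Finsupp.linearCombination_apply, Finsupp.sum,
    map_sum, LinearMap.sum_apply]
  refine Submodule.sum_mem _ fun u _ => ?_
  rw [map_smul, LinearMap.smul_apply]
  refine Submodule.smul_mem _ _ ?_
  rw [← wordBasis.linearCombination_repr y, Finsupp.linearCombination_apply, Finsupp.sum, map_sum]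
  refine Submodule.sum_mem _ fun v _ => ?_
  rw [map_smul]
  refine Submodule.smul_mem _ _ ?_
  rw [wordBasis_apply, wordBasis_apply, circledast, linExt_word, linExt_word]
  exact key u v

end QMZV

namespace QMZV

/-! ### `q`-integers -/

/-! For fixed `w` in `𝔥¹_{>0}`, put `F_w(X) = ∑_m c_m (q^m/[m]) X ∏_{j<m} (1 + X/[j])`, where `c_m`
is the `m`-th increment of the star sums `A (dq (phi w))`. The coefficient of `X^n` is
`ζ_q(d_q(φ(w)) ⊛_q z_1^n)` (`genPoly_coeff_succ`, for truncations), so the claim is `F_{w₁ *_- w₂} +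
F_{w₁} F_{w₂} = 0`.

At `X = -[N]` the products vanish for `m > N`, and a finite duality (`sum_kernel_starTerm`,
`genPoly_phi_eval`) gives `F_w(-[N]) = -S_w(N)`, where `S_w` is the star sum with weights
`q^m/[m]^k`. Since `S` is multiplicative for `*_-` (`dualStar_harmonicMinus`), the relation holds at
every `X = -[N]`. Modulo `q^L` both `F_{w₁ *_- w₂}` and the product are polynomials of degree at
most `2L`, and `2L + 1` such roots force them to cancel (`sum_coeff_dvd`). As `L` is arbitrary, the
theorem follows.

The duality is an induction along the recursion for `φ`. Raising `k_1` by one prepends `z_1` to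
`φ(u)`, which Abel summation turns into a factor `1/[N]`. Prepending `z_1` to `u` raises the first
index of `φ(u)`, which a recurrence in `N` turns into a summation over `l ≤ N`. -/

theorem one_sub_q_mul_inv : (1 - q) * (1 - q)⁻¹ = 1 :=
  PowerSeries.mul_inv_cancel _ (by simp)

theorem one_sub_q_mul_qInt (m : ℕ) : (1 - q) * qInt m = 1 - q ^ m := by
  rw [qInt, mul_left_comm, one_sub_q_mul_inv, mul_one]

theorem qInt_zero : qInt 0 = 0 := by simp [qInt]

theorem qInt_succ (m : ℕ) : qInt (m + 1) = 1 + q * qInt m := by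
  simp only [qInt]
  linear_combination one_sub_q_mul_inv

theorem qInt_injective : Function.Injective qInt := by
  intro m n h
  have h1 : q ^ m = q ^ n := by
    linear_combination one_sub_q_mul_qInt m - one_sub_q_mul_qInt n - (1 - q) * h
  have h2 := congrArg (PowerSeries.coeff m) h1
  by_contra hne
  simp [PowerSeries.coeff_X_pow, hne] at h2

/-- The inverse of the `q`-integer `[m + 1]`. -/
noncomputable def qInv (m : ℕ) : R := (qInt (m + 1))⁻¹

theorem qInt_mul_qInv (m : ℕ) : qInt (m + 1) * qInv m = 1 :=
  PowerSeries.mul_inv_cancel _ (by simp [qInt_succ])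

theorem inv_qInt_pow (m k : ℕ) : (qInt (m + 1) ^ k)⁻¹ = qInv m ^ k := by
  have h : qInt (m + 1) ^ k * qInv m ^ k = 1 := by
    rw [← mul_pow, qInt_mul_qInv, one_pow]
  have h0 : PowerSeries.constantCoeff (qInt (m + 1) ^ k) ≠ 0 := by simp [qInt_succ]
  rw [eq_comm, PowerSeries.eq_inv_iff_mul_eq_one h0, mul_comm, h]

/-- This is `1 = q^m + (1 - q)[m]` divided by `[m]`, with the index shifted. It is the source of the
`ħ`-terms in both harmonic products. -/
theorem qInv_eq (m : ℕ) : qInv m = q ^ (m + 1) * qInv m + (1 - q) := by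
  linear_combination (1 - q) * qInt_mul_qInv m - qInv m * one_sub_q_mul_qInt (m + 1)

/-! ### Iterated sums with general weights -/

/-- `∑ ∏ f k_i m_i` over `n > m_1`, `m_i + e > m_{i+1}`: strict sums for `e = 0`, star sums for
`e = 1`. -/
noncomputable def iterSum (f : ℕ+ → ℕ → R) (e : ℕ) : List ℕ+ → ℕ → R
  | [], _ => 1
  | k :: u, n => ∑ m ∈ Finset.range n, f k m * iterSum f e u (m + e)

theorem iterSum_cons_succ (f : ℕ+ → ℕ → R) (e : ℕ) (k : ℕ+) (u : List ℕ+) (n : ℕ) :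
    iterSum f e (k :: u) (n + 1) = iterSum f e (k :: u) n + f k n * iterSum f e u (n + e) := by
  simp only [iterSum, Finset.sum_range_succ]

theorem iterSum_cons_zero (f : ℕ+ → ℕ → R) (e : ℕ) (k : ℕ+) (u : List ℕ+) :
    iterSum f e (k :: u) 0 = 0 := by simp [iterSum]

/-- The extension of a function on words to `𝔥¹` which is semilinear over `coeffHom`. -/
noncomputable def extend (g : List ℕ+ → R) : H1 →ₛₗ[coeffHom] R where
  toFun w := (wordBasis.repr w).sum fun u c => coeffHom c * g u
  map_add' x y := by
    rw [map_add, Finsupp.sum_add_index' (by simp) (by intros; simp [add_mul])]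
  map_smul' c x := by
    rw [map_smul, Finsupp.sum_smul_index (by simp), smul_eq_mul, Finsupp.mul_sum]
    simp [mul_assoc]

theorem extend_word (g : List ℕ+ → R) (u : List ℕ+) : extend g (word u) = g u := by
  change (wordBasis.repr (word u)).sum (fun u c => coeffHom c * g u) = g u
  rw [← wordBasis_apply, Module.Basis.repr_self, Finsupp.sum_single_index] <;> simp

theorem A_eq_extend (w : H1) (n : ℕ) : A w n = extend (fun u => AWord u n) w := rfl

theorem word_nil : word [] = 1 := by simp [word]

theorem word_cons (i : ℕ+) (u : List ℕ+) : word (i :: u) = z i * word u := by simp [word]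

theorem word_induction {p : H1 → Prop} (hword : ∀ u, p (word u))
    (hadd : ∀ x y, p x → p y → p (x + y)) (hsmul : ∀ (c : C) x, p x → p (c • x)) (x : H1) :
    p x := by
  induction wordBasis.mem_span x using Submodule.span_induction with
  | mem x hx =>
    obtain ⟨u, rfl⟩ := hx
    rw [wordBasis_apply]
    exact hword u
  | zero => simpa using hsmul 0 _ (hword [])
  | add x y _ _ hx hy => exact hadd x y hx hy
  | smul c x _ hx => exact hsmul c x hx

theorem coeffHom_hbar : coeffHom hbar = 1 - q := by simp [coeffHom]

theorem extend_iterSum_z_mul (f : ℕ+ → ℕ → R) (e : ℕ) (i : ℕ+) (x : H1) (n : ℕ) :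
    extend (fun u => iterSum f e u n) (z i * x) =
      ∑ m ∈ Finset.range n, f i m * extend (fun u => iterSum f e u (m + e)) x := by
  induction x using word_induction with
  | hword u => rw [← word_cons, extend_word, iterSum]; simp only [extend_word]
  | hadd x y hx hy => simp only [mul_add, map_add, hx, hy, Finset.sum_add_distrib]
  | hsmul c x hx =>
    rw [mul_smul_comm, LinearMap.map_smulₛₗ, hx, smul_eq_mul, Finset.mul_sum]
    refine Finset.sum_congr rfl fun m _ => ?_
    rw [LinearMap.map_smulₛₗ, smul_eq_mul]
    ring

theorem extend_iterSum_letterProd_mul (f : ℕ+ → ℕ → R) (e : ℕ) (s : C) (i j : ℕ+) (x : H1)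
    (n : ℕ) :
    extend (fun u => iterSum f e u n) (letterProd s i j * x) =
      ∑ m ∈ Finset.range n, (coeffHom s * f (i + j) m + (1 - q) * f (i + j - 1) m) *
        extend (fun u => iterSum f e u (m + e)) x := by
  rw [letterProd, add_mul, smul_mul_assoc, smul_mul_assoc, map_add, LinearMap.map_smulₛₗ,
    LinearMap.map_smulₛₗ, extend_iterSum_z_mul, extend_iterSum_z_mul, coeffHom_hbar, smul_eq_mul,
    smul_eq_mul, Finset.mul_sum, Finset.mul_sum, ← Finset.sum_add_distrib]
  exact Finset.sum_congr rfl fun m _ => by ring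

/-- Iterated sums are multiplicative on words for the harmonic product which reflects the products
of the weights. -/
theorem extend_iterSum_harmonicWord (f : ℕ+ → ℕ → R) (e : ℕ) (s : C)
    (h : e = 0 ∧ (∀ i j m, coeffHom s * f (i + j) m + (1 - q) * f (i + j - 1) m = f i m * f j m) ∨
      e = 1 ∧ (∀ i j m, coeffHom s * f (i + j) m + (1 - q) * f (i + j - 1) m = -(f i m * f j m)))
    (u v : List ℕ+) (n : ℕ) :
    extend (fun u => iterSum f e u n) (harmonicWord s u v) = iterSum f e u n * iterSum f e v n := by
  induction u, v using harmonicWord.induct generalizing n with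
  | case1 v => rw [harmonicWord, extend_word]; simp [iterSum]
  | case2 i u => rw [harmonicWord, extend_word]; simp [iterSum]
  | case3 i u j v h1 h2 h3 =>
    rw [harmonicWord, map_add, map_add, extend_iterSum_z_mul, extend_iterSum_z_mul,
      extend_iterSum_letterProd_mul]
    simp only [h1, h2, h3]
    induction n with
    | zero => simp [iterSum_cons_zero]
    | succ n ih =>
      simp only [Finset.sum_range_succ]
      -- Both cases expand the increment of a product. For strict sums the two letter terms miss the
      -- diagonal, which the third term adds; for star sums they count it twice, so the third term
      -- has the opposite sign.
      rcases h with ⟨rfl, h⟩ | ⟨rfl, h⟩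
      · simp only [iterSum_cons_succ, h, add_zero] at ih ⊢
        linear_combination ih
      · rw [h]
        simp only [iterSum_cons_succ] at ih ⊢
        linear_combination ih

theorem extend_iterSum_harmonicProd (f : ℕ+ → ℕ → R) (e : ℕ) (s : C)
    (h : e = 0 ∧ (∀ i j m, coeffHom s * f (i + j) m + (1 - q) * f (i + j - 1) m = f i m * f j m) ∨
      e = 1 ∧ (∀ i j m, coeffHom s * f (i + j) m + (1 - q) * f (i + j - 1) m = -(f i m * f j m)))
    (x y : H1) (n : ℕ) :
    extend (fun u => iterSum f e u n) (harmonicProd s x y) =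
      extend (fun u => iterSum f e u n) x * extend (fun u => iterSum f e u n) y := by
  induction x using word_induction with
  | hword u =>
    induction y using word_induction with
    | hword v =>
      rw [harmonicProd, linExt_word, linExt_word, extend_word, extend_word,
        extend_iterSum_harmonicWord f e s h]
    | hadd x y hx hy => rw [map_add, map_add, map_add, hx, hy, mul_add]
    | hsmul c x hx =>
      rw [map_smul, LinearMap.map_smulₛₗ, LinearMap.map_smulₛₗ, hx, smul_eq_mul, smul_eq_mul]
      ring
  | hadd x y hx hy => rw [map_add, LinearMap.add_apply, map_add, map_add, hx, hy, add_mul]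
  | hsmul c x hx =>
    rw [map_smul, LinearMap.smul_apply, LinearMap.map_smulₛₗ, LinearMap.map_smulₛₗ, hx,
      smul_eq_mul, smul_eq_mul, mul_assoc]

/-- The weights `q^{(k-1)m} / [m]^k`, with `m` shifted by one. -/
noncomputable def zetaWeight (k : ℕ+) (m : ℕ) : R := (q ^ (m + 1)) ^ ((k : ℕ) - 1) * qInv m ^ (k : ℕ)

/-- The weights `q^m / [m]^k`, with `m` shifted by one. -/
noncomputable def dualWeight (k : ℕ+) (m : ℕ) : R := q ^ (m + 1) * qInv m ^ (k : ℕ)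

theorem PNat_exists_add_one (i : ℕ+) : ∃ a : ℕ, (i : ℕ) = a + 1 :=
  ⟨(i : ℕ) - 1, (Nat.sub_add_cancel i.pos).symm⟩

theorem PNat_add_sub_one_coe (i j : ℕ+) : ((i + j - 1 : ℕ+) : ℕ) = (i : ℕ) + j - 1 := by
  have hi := i.pos
  have hj := j.pos
  rw [PNat.sub_coe, if_pos]
  · simp
  · rw [← PNat.coe_lt_coe]
    push_cast
    omega

theorem zetaWeight_mul (i j : ℕ+) (m : ℕ) :
    coeffHom 1 * zetaWeight (i + j) m + (1 - q) * zetaWeight (i + j - 1) m =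
      zetaWeight i m * zetaWeight j m := by
  obtain ⟨a, ha⟩ := PNat_exists_add_one i
  obtain ⟨b, hb⟩ := PNat_exists_add_one j
  simp only [zetaWeight, PNat_add_sub_one_coe, PNat.add_coe, ha, hb, map_one]
  rw [show a + 1 + (b + 1) - 1 = a + b + 1 by omega, show a + 1 + (b + 1) = a + b + 2 by omega]
  simp only [Nat.add_sub_cancel]
  linear_combination -(q ^ (m + 1)) ^ (a + b) * qInv m ^ (a + b + 1) * qInv_eq m

theorem dualWeight_mul (i j : ℕ+) (m : ℕ) :
    coeffHom (-1) * dualWeight (i + j) m + (1 - q) * dualWeight (i + j - 1) m =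
      -(dualWeight i m * dualWeight j m) := by
  obtain ⟨a, ha⟩ := PNat_exists_add_one i
  obtain ⟨b, hb⟩ := PNat_exists_add_one j
  simp only [dualWeight, PNat_add_sub_one_coe, PNat.add_coe, ha, hb, map_one, map_neg]
  rw [show a + 1 + (b + 1) - 1 = a + b + 1 by omega, show a + 1 + (b + 1) = a + b + 2 by omega]
  linear_combination -q ^ (m + 1) * qInv m ^ (a + b + 1) * qInv_eq m

theorem AWord_eq_iterSum (u : List ℕ+) (n : ℕ) : AWord u n = iterSum zetaWeight 0 u n := by
  induction u generalizing n with
  | nil => rfl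
  | cons k u ih =>
    rw [AWord, iterSum]
    refine Finset.sum_congr rfl fun m _ => ?_
    rw [ih, inv_qInt_pow, zetaWeight, ← pow_mul, mul_comm ((k : ℕ) - 1), add_zero]

theorem A_eq_extend_iterSum (w : H1) (n : ℕ) :
    A w n = extend (fun u => iterSum zetaWeight 0 u n) w := by
  simp only [A_eq_extend, AWord_eq_iterSum]

theorem A_z_mul (i : ℕ+) (x : H1) (n : ℕ) :
    A (z i * x) n = ∑ m ∈ Finset.range n, zetaWeight i m * A x m := by
  simp only [A_eq_extend_iterSum, extend_iterSum_z_mul, add_zero]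

theorem A_harmonicPlus (x y : H1) (n : ℕ) : A (harmonicPlus x y) n = A x n * A y n := by
  simp only [A_eq_extend_iterSum]
  exact extend_iterSum_harmonicProd _ _ _ (.inl ⟨rfl, zetaWeight_mul⟩) _ _ _

/-- The star sums `∑_{n ≥ m_1 ≥ ⋯ ≥ m_r > 0} ∏ q^{m_i} / [m_i]^{k_i}`, extended to `𝔥¹`. -/
noncomputable def dualStar (w : H1) (n : ℕ) : R := extend (fun u => iterSum dualWeight 1 u n) w

theorem dualStar_harmonicMinus (x y : H1) (n : ℕ) :
    dualStar (harmonicMinus x y) n = dualStar x n * dualStar y n :=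
  extend_iterSum_harmonicProd _ _ _ (.inr ⟨rfl, dualWeight_mul⟩) _ _ _

theorem dualStar_zero_of_mem (x : H1) (hx : x ∈ H1pos) : dualStar x 0 = 0 := by
  unfold H1pos at hx
  induction hx using Submodule.span_induction with
  | mem x hx =>
    obtain ⟨u, hu, rfl⟩ := hx
    obtain ⟨k, u, rfl⟩ := List.exists_cons_of_ne_nil hu
    rw [dualStar, extend_word, iterSum_cons_zero]
  | zero => simp [dualStar]
  | add x y _ _ hx hy =>
    unfold dualStar at hx hy ⊢
    rw [map_add, hx, hy, add_zero]
  | smul c x _ hx =>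
    unfold dualStar at hx ⊢
    rw [LinearMap.map_smulₛₗ, hx, smul_zero]

/-! ### `d_q` and star sums, `⊛_q` -/

theorem A_zero (n : ℕ) : A 0 n = 0 := by simp [A]

/-- Merging `z_i` into the first letter of `x` multiplies by the weight of `z_i` at the largest
index. The increment of `A x` isolates the part with that index, and it kills constants, as `∘_+`
does. -/
theorem A_circPlus (i : ℕ+) (x : H1) (n : ℕ) :
    A (circPlus i x) n = ∑ m ∈ Finset.range n, zetaWeight i m * (A x (m + 1) - A x m) := by
  induction x using word_induction with
  | hword u =>
    rw [circPlus, linExt_word]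
    rcases u with _ | ⟨j, u⟩
    · simp [A_word, AWord, A_zero]
    · simp only [A_eq_extend_iterSum, extend_iterSum_letterProd_mul, zetaWeight_mul, extend_word,
        iterSum_cons_succ, add_sub_cancel_left, mul_assoc, add_zero]
  | hadd x y hx hy =>
    simp only [map_add, A_add, hx, hy, ← Finset.sum_add_distrib]
    exact Finset.sum_congr rfl fun m _ => by ring
  | hsmul c x hx =>
    simp only [map_smul, A_smul, hx, Finset.mul_sum]
    exact Finset.sum_congr rfl fun m _ => by ring

/-- The two terms of `d_q` contribute `A x m` (strict inequality) and `A x (m + 1) - A x m`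
(equality), which add up to the weak inequality. -/
theorem A_dq_word (u : List ℕ+) (n : ℕ) : A (dq (word u)) n = iterSum zetaWeight 1 u n := by
  rw [dq, linExt_word]
  induction u generalizing n with
  | nil => rw [dqWord, ← word_nil, A_word, AWord, iterSum]
  | cons i u ih =>
    rw [dqWord, A_add, A_z_mul, A_circPlus, iterSum, ← Finset.sum_add_distrib]
    refine Finset.sum_congr rfl fun m _ => ?_
    rw [← ih]
    ring

theorem z_one_pow (n : ℕ) : z 1 ^ n = word (List.replicate n 1) := by simp [word]

theorem zetaWeight_add_one (i : ℕ+) (m : ℕ) :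
    zetaWeight (i + 1) m = zetaWeight i m * (q ^ (m + 1) * qInv m) := by
  obtain ⟨a, ha⟩ := PNat_exists_add_one i
  simp only [zetaWeight, PNat.add_coe, ha, PNat.one_coe, Nat.add_sub_cancel]
  ring

/-- The increment of `A x` fixes the largest index, the factor `q^m/[m]` raises the exponent there
by one, and the remaining letters of the two words run independently below it. -/
theorem A_circledast_z_one_pow (x : H1) (n N : ℕ) :
    A (circledast x (z 1 ^ (n + 1))) N = ∑ m ∈ Finset.range N,
      (A x (m + 1) - A x m) * (q ^ (m + 1) * qInv m) * AWord (List.replicate n 1) m := by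
  induction x using word_induction with
  | hword u =>
    rw [z_one_pow, circledast, linExt_word, linExt_word, List.replicate_succ]
    rcases u with _ | ⟨j, u⟩
    · simp [circledastWord, A_word, AWord, A_zero]
    · rw [circledastWord, A_z_mul]
      refine Finset.sum_congr rfl fun m _ => ?_
      rw [A_harmonicPlus, A_word, A_word, A_word, A_word, AWord_eq_iterSum (j :: u),
        AWord_eq_iterSum (j :: u), iterSum_cons_succ, zetaWeight_add_one, AWord_eq_iterSum u,
        add_zero]
      ring
  | hadd x y hx hy =>
    simp only [map_add, LinearMap.add_apply, A_add, hx, hy, ← Finset.sum_add_distrib]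
    exact Finset.sum_congr rfl fun m _ => by ring
  | hsmul c x hx =>
    simp only [map_smul, LinearMap.smul_apply, A_smul, hx, Finset.mul_sum]
    exact Finset.sum_congr rfl fun m _ => by ring


/-! ### Recursion for `φ` -/

theorem weight_cons (k : ℕ+) (u : List ℕ+) : weight (k :: u) = k + weight u := by simp [weight]

theorem mem_partialSums_cons_cons (k j : ℕ+) (u : List ℕ+) (p : ℕ) :
    p ∈ partialSums (k :: j :: u) ↔ p = k ∨ ∃ p', p' ∈ partialSums (j :: u) ∧ p = k + p' := by
  simp only [partialSums, Finset.mem_image, Finset.mem_Ico, List.length_cons]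
  constructor
  · rintro ⟨t, ⟨h1, h2⟩, rfl⟩
    obtain ⟨t, rfl⟩ : ∃ s, t = s + 1 := ⟨t - 1, by omega⟩
    rw [List.take_succ_cons, weight_cons]
    rcases Nat.eq_zero_or_pos t with rfl | ht
    · simp [weight]
    · exact Or.inr ⟨_, ⟨t, ⟨ht, by omega⟩, rfl⟩, rfl⟩
  · rintro (rfl | ⟨_, ⟨t, ⟨h1, h2⟩, rfl⟩, rfl⟩)
    · exact ⟨1, ⟨le_rfl, by omega⟩, by simp [weight]⟩
    · exact ⟨t + 1, ⟨by omega, by omega⟩, by rw [List.take_succ_cons, weight_cons]⟩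

theorem partialSums_singleton (k : ℕ+) : partialSums [k] = ∅ := by simp [partialSums]

theorem le_of_mem_partialSums (k : ℕ+) (u : List ℕ+) (p : ℕ) (h : p ∈ partialSums (k :: u)) :
    (k : ℕ) ≤ p := by
  rcases u with _ | ⟨j, u⟩
  · simp [partialSums_singleton] at h
  · rcases (mem_partialSums_cons_cons k j u p).1 h with rfl | ⟨p', -, rfl⟩ <;> omega

theorem mem_partialSums_succ (k : ℕ+) (u : List ℕ+) (p : ℕ) :
    p + 1 ∈ partialSums ((k + 1) :: u) ↔ p ∈ partialSums (k :: u) := by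
  rcases u with _ | ⟨j, u⟩
  · simp [partialSums_singleton]
  · rw [mem_partialSums_cons_cons, mem_partialSums_cons_cons]
    simp only [PNat.add_coe, PNat.one_coe]
    refine or_congr (by omega) (exists_congr fun p' => and_congr_right fun _ => by omega)

theorem mem_partialSums_one_cons (j : ℕ+) (u : List ℕ+) (p : ℕ) (hp : 1 ≤ p) :
    p + 1 ∈ partialSums (1 :: j :: u) ↔ p ∈ partialSums (j :: u) := by
  rw [mem_partialSums_cons_cons]
  simp only [PNat.one_coe]
  constructor
  · rintro (h | ⟨p', h, h'⟩)
    · omega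
    · rwa [show p = p' by omega]
  · exact fun h => Or.inr ⟨p, h, by omega⟩

theorem range'_succ_eq_map (n : ℕ) :
    List.range' 1 (n + 1) = 1 :: (List.range' 1 n).map (· + 1) := by
  rw [List.range'_succ, ← List.range'_succ_left]

theorem complList_succ (k : ℕ+) (u : List ℕ+) :
    complList ((k + 1) :: u) = 1 :: (complList (k :: u)).map (· + 1) := by
  have h1 : 1 ∉ partialSums ((k + 1) :: u) := fun h => by
    have := le_of_mem_partialSums _ _ _ h
    have := k.pos
    simp only [PNat.add_coe, PNat.one_coe] at *
    omega
  have hw : weight ((k + 1) :: u) = weight (k :: u) + 1 := by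
    simp only [weight_cons, PNat.add_coe, PNat.one_coe]
    omega
  rw [complList, hw, range'_succ_eq_map, List.filter_cons_of_pos (by simpa using h1),
    List.filter_map, complList]
  congr 2
  exact List.filter_congr fun p _ => by simp [mem_partialSums_succ]

theorem complList_one_cons (j : ℕ+) (u : List ℕ+) :
    complList (1 :: j :: u) = (complList (j :: u)).map (· + 1) := by
  have h1 : 1 ∈ partialSums (1 :: j :: u) := by
    rw [mem_partialSums_cons_cons]
    exact Or.inl rfl
  have hw : weight (1 :: j :: u) = weight (j :: u) + 1 := by
    rw [weight_cons, PNat.one_coe, add_comm]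
  rw [complList, hw, range'_succ_eq_map, List.filter_cons_of_neg (by simpa using h1),
    List.filter_map, complList]
  congr 1
  refine List.filter_congr fun p hp => ?_
  -- The equivalence fails at `p = 0`, where the shifted point `1` is the first partial sum.
  have hp : 1 ≤ p := by
    rw [List.mem_range'_1] at hp
    exact hp.1
  simp [mem_partialSums_one_cons j u p hp]

theorem gaps_map_succ (a : ℕ) (l : List ℕ) : gaps (a + 1) (l.map (· + 1)) = gaps a l := by
  induction l generalizing a with
  | nil => rfl
  | cons p l ih => rw [List.map_cons, gaps, gaps, ih, Nat.add_sub_add_right]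

/-- The point `1` is not a partial sum here, so it opens the complement with a gap of `1`, and the
other points are shifted. -/
theorem phiWord_succ_cons (k : ℕ+) (u : List ℕ+) :
    phiWord ((k + 1) :: u) = 1 :: phiWord (k :: u) := by
  rw [phiWord, complList_succ, gaps, gaps_map_succ]
  rfl

theorem phiWord_one : phiWord [1] = [1] := by decide +kernel

/-- `φ(z_1 w)` is obtained from `φ(w)` by raising the index of the first letter. -/
theorem phiWord_one_cons (j k : ℕ+) (u v : List ℕ+) (h : phiWord (j :: u) = k :: v) :
    phiWord (1 :: j :: u) = (k + 1) :: v := by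
  rw [phiWord, complList_one_cons]
  have hpos : ∀ p ∈ complList (j :: u), 1 ≤ p := fun p hp => by
    have := (List.mem_filter.1 hp).1
    rw [List.mem_range'_1] at this
    exact this.1
  rw [phiWord] at h
  rcases hl : complList (j :: u) with _ | ⟨p, l⟩
  · simp [hl, gaps] at h
  · have hp : 1 ≤ p := hpos p (by simp [hl])
    rw [hl, gaps, List.cons.injEq] at h
    rw [List.map_cons, gaps, gaps_map_succ, h.2, ← h.1]
    congr 1
    apply PNat.eq
    simp only [Nat.sub_zero, PNat.add_coe, PNat.one_coe, Nat.toPNat'_coe]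
    simp [show 0 < p by omega]

theorem phiWord_nil : phiWord [] = [] := by decide +kernel


/-! ### The finite duality -/

/-- `∏_{1 ≤ j ≤ m} (1 - [N] / [j])`, which is `(-1)^m q^{m(m+1)/2}` times a `q`-binomial
coefficient. -/
noncomputable def kernel (N m : ℕ) : R := ∏ j ∈ Finset.range m, (1 - qInt N * qInv j)

theorem kernel_succ (N m : ℕ) : kernel N (m + 1) = kernel N m * (1 - qInt N * qInv m) :=
  Finset.prod_range_succ _ _

/-- This kills the boundary term of Abel summation, so the cutoff `M` in the sums below is
immaterial once it exceeds `N`. -/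
theorem kernel_eq_zero (N m : ℕ) (h : N < m) : kernel (N + 1) m = 0 :=
  Finset.prod_eq_zero (Finset.mem_range.2 h) (by rw [qInt_mul_qInv, sub_self])

/-- Since `[j+1] - [N+1] = q([j] - [N])`, the numerators for `N` and `N + 1` agree up to powers of
`q` and the two end factors `[1] - [N+1] = -q[N]` and `[m+1] - [N+1]`. -/
theorem kernel_recurrence (N m : ℕ) :
    q ^ (m + 1) * (qInt N * kernel N m) =
      (qInt (N + 1) - qInt (m + 1)) * kernel (N + 1) m := by
  induction m with
  | zero => simp [kernel, qInt_succ, qInt_zero]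
  | succ m ih =>
    rw [kernel_succ, kernel_succ]
    have h := qInt_mul_qInv m
    have h1 := qInt_succ N
    have h2 := qInt_succ (m + 1)
    linear_combination q * (1 - qInt N * qInv m) * ih + kernel (N + 1) m *
      ((qInt (N + 1) - qInt (m + 1)) * qInv m * h1 + (1 - qInt (N + 1) * qInv m) * h2 +
        (qInt (N + 1) - 1 - q * qInt (N + 1)) * h)

/-- Abel summation, from `kernel N m - kernel N (m + 1) = [N] kernel N m / [m+1]`. -/
theorem sum_kernel_mul_sum (N M : ℕ) (s : ℕ → R) :
    qInt N * ∑ m ∈ Finset.range M, kernel N m * (qInv m * ∑ j ∈ Finset.range (m + 1), s j) =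
      ∑ m ∈ Finset.range M, kernel N m * s m - kernel N M * ∑ j ∈ Finset.range M, s j := by
  induction M with
  | zero => simp
  | succ M ih =>
    rw [Finset.sum_range_succ, mul_add, ih, Finset.sum_range_succ _ M, Finset.sum_range_succ _ M,
      kernel_succ]
    ring

/-- By `kernel_recurrence`, passing from `N` to `N + 1` changes `[N] kernel N m q^(m+1)/[m+1]` by
exactly `q^(N+1) kernel (N + 1) m`; the identity telescopes this. -/
theorem sum_kernel_mul_pow (N M : ℕ) (s : ℕ → R) :
    qInt N * ∑ m ∈ Finset.range M, kernel N m * (q ^ (m + 1) * qInv m * s m) =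
      ∑ l ∈ Finset.range N, q ^ (l + 1) * ∑ m ∈ Finset.range M, kernel (l + 1) m * s m := by
  induction N with
  | zero => simp [qInt_zero]
  | succ N ih =>
    rw [Finset.sum_range_succ, ← ih, Finset.mul_sum, Finset.mul_sum, Finset.mul_sum,
      ← Finset.sum_add_distrib]
    refine Finset.sum_congr rfl fun m _ => ?_
    have h := qInt_mul_qInv m
    have h1 := one_sub_q_mul_qInt (N + 1)
    have h2 := one_sub_q_mul_qInt (m + 1)
    have h3 := kernel_recurrence N m
    linear_combination -qInv m * s m * h3 + kernel (N + 1) m * s m *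
      (qInt (N + 1) * qInv m * h2 - h1 + (1 - (1 - q) * qInt (N + 1)) * h)

/-- The summand of the star sum of a non-empty word which belongs to the largest index. -/
noncomputable def starTerm (f : ℕ+ → ℕ → R) : List ℕ+ → ℕ → R
  | [], _ => 0
  | k :: u, m => f k m * iterSum f 1 u (m + 1)

theorem iterSum_one_eq_sum (f : ℕ+ → ℕ → R) (u : List ℕ+) (hu : u ≠ []) (n : ℕ) :
    iterSum f 1 u n = ∑ m ∈ Finset.range n, starTerm f u m := by
  obtain ⟨k, u, rfl⟩ := List.exists_cons_of_ne_nil hu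
  rfl

theorem phiWord_ne_nil (k : ℕ+) (u : List ℕ+) : phiWord (k :: u) ≠ [] := by
  induction u generalizing k with
  | nil =>
    induction k using PNat.recOn with
    | one => simp [phiWord_one]
    | succ k _ => simp [phiWord_succ_cons]
  | cons j u ih =>
    induction k using PNat.recOn with
    | one =>
      obtain ⟨i, v, h⟩ := List.exists_cons_of_ne_nil (ih j)
      simp [phiWord_one_cons j i u v h]
    | succ k _ => simp [phiWord_succ_cons]

theorem zetaWeight_one (m : ℕ) : zetaWeight 1 m = qInv m := by simp [zetaWeight]

theorem sum_kernel_starTerm_succ (k : ℕ+) (u : List ℕ+) (M N : ℕ) (hN : N < M) :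
    ∑ m ∈ Finset.range M, kernel (N + 1) m * starTerm zetaWeight (phiWord ((k + 1) :: u)) m =
      qInv N * ∑ m ∈ Finset.range M,
        kernel (N + 1) m * starTerm zetaWeight (phiWord (k :: u)) m := by
  have h := sum_kernel_mul_sum (N + 1) M (starTerm zetaWeight (phiWord (k :: u)))
  rw [kernel_eq_zero N M hN, zero_mul, sub_zero] at h
  rw [← h, ← mul_assoc, mul_comm (qInv N), qInt_mul_qInv, one_mul]
  refine Finset.sum_congr rfl fun m _ => ?_
  rw [phiWord_succ_cons, starTerm, zetaWeight_one, iterSum_one_eq_sum _ _ (phiWord_ne_nil k u)]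

/-- The finite duality: the kernel transform carries the top terms of the star sum of `φ(u)` to
those of the dual star sum of `u`, up to the factor `q^(N+1)`. The two moves of the recursion for
`φ` correspond to `sum_kernel_mul_sum` and `sum_kernel_mul_pow`. -/
theorem sum_kernel_starTerm (k : ℕ+) (u : List ℕ+) (M N : ℕ) (hN : N < M) :
    ∑ m ∈ Finset.range M, kernel (N + 1) m * starTerm zetaWeight (phiWord (k :: u)) m =
      qInv N ^ (k : ℕ) * iterSum dualWeight 1 u (N + 1) := by
  induction u generalizing k N with
  | nil =>
    induction k using PNat.recOn with
    | one =>
      -- With `s` supported at `0`, all its partial sums are `1`, and Abel summation evaluates `∑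
      -- kernel / [m]`.
      have h := sum_kernel_mul_sum (N + 1) M (fun m => if m = 0 then 1 else 0)
      rw [kernel_eq_zero N M hN, zero_mul, sub_zero] at h
      have h1 : ∀ m, ∑ j ∈ Finset.range (m + 1), (if j = 0 then (1 : R) else 0) = 1 := by
        intro m
        simp
      simp only [h1, mul_one] at h
      simp only [mul_ite, mul_one, mul_zero, Finset.sum_ite_eq', Finset.mem_range,
        show 0 < M by omega, if_true] at h
      have h0 : kernel (N + 1) 0 = 1 := by simp [kernel]
      rw [h0] at h
      simp only [phiWord_one, starTerm, zetaWeight_one, iterSum, mul_one, PNat.one_coe, pow_one]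
      linear_combination qInv N * h - (∑ m ∈ Finset.range M, kernel (N + 1) m * qInv m) *
        qInt_mul_qInv N
    | succ k ih =>
      rw [sum_kernel_starTerm_succ k _ M N hN, ih, PNat.add_coe, PNat.one_coe]
      ring
  | cons j u ih =>
    induction k using PNat.recOn with
    | one =>
      obtain ⟨i, v, h⟩ := List.exists_cons_of_ne_nil (phiWord_ne_nil j u)
      have h1 := sum_kernel_mul_pow (N + 1) M (starTerm zetaWeight (phiWord (j :: u)))
      have h2 : ∑ l ∈ Finset.range (N + 1), q ^ (l + 1) * ∑ m ∈ Finset.range M,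
          kernel (l + 1) m * starTerm zetaWeight (phiWord (j :: u)) m =
          iterSum dualWeight 1 (j :: u) (N + 1) := by
        rw [iterSum]
        refine Finset.sum_congr rfl fun l hl => ?_
        rw [ih j l (by rw [Finset.mem_range] at hl; omega), dualWeight, mul_assoc]
      rw [h2] at h1
      rw [← h1, PNat.one_coe, pow_one, ← mul_assoc, mul_comm (qInv N), qInt_mul_qInv, one_mul,
        phiWord_one_cons j i u v h, h]
      refine Finset.sum_congr rfl fun m _ => ?_
      rw [starTerm, starTerm, zetaWeight_add_one]
      ring
    | succ k ih =>
      rw [sum_kernel_starTerm_succ k _ M N hN, ih, PNat.add_coe, PNat.one_coe]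
      ring

/-! ### The generating polynomials -/

/-- `∑_{1 ≤ m ≤ M} c_m (q^m / [m]) X ∏_{j < m} (1 + X / [j])`. -/
noncomputable def genPoly (M : ℕ) (c : ℕ → R) : Polynomial R :=
  ∑ m ∈ Finset.range M, Polynomial.C (c m * (q ^ (m + 1) * qInv m)) *
    (Polynomial.X * ∏ j ∈ Finset.range m, (1 + Polynomial.C (qInv j) * Polynomial.X))

theorem coeff_prod_qInv (n m : ℕ) :
    (∏ j ∈ Finset.range m, (1 + Polynomial.C (qInv j) * Polynomial.X)).coeff n =
      AWord (List.replicate n 1) m := by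
  induction m generalizing n with
  | zero => cases n <;> simp [List.replicate_succ, AWord, Polynomial.coeff_one]
  | succ m ih =>
    rw [Finset.prod_range_succ, mul_add, mul_one, Polynomial.coeff_add, ← mul_assoc]
    rcases n with _ | n
    · rw [Polynomial.mul_coeff_zero, ih]
      simp [AWord]
    · rw [Polynomial.coeff_mul_X, Polynomial.coeff_mul_C, ih, ih, List.replicate_succ,
        AWord_eq_iterSum, AWord_eq_iterSum, AWord_eq_iterSum, iterSum_cons_succ, zetaWeight_one,
        add_zero]
      ring

theorem genPoly_coeff_zero (M : ℕ) (c : ℕ → R) : (genPoly M c).coeff 0 = 0 := by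
  simp [genPoly, Polynomial.finsetSum_coeff]

theorem genPoly_coeff_succ (M : ℕ) (x : H1) (n : ℕ) :
    (genPoly M fun m => A x (m + 1) - A x m).coeff (n + 1) =
      A (circledast x (z 1 ^ (n + 1))) M := by
  rw [genPoly, Polynomial.finsetSum_coeff, A_circledast_z_one_pow]
  refine Finset.sum_congr rfl fun m _ => ?_
  rw [Polynomial.coeff_C_mul, Polynomial.coeff_X_mul, coeff_prod_qInv]

/-- At `X = -[N]` the factors `1 + X/[j]` become those of `kernel N m`. -/
theorem genPoly_eval (M N : ℕ) (c : ℕ → R) :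
    (genPoly M c).eval (-qInt N) =
      -∑ l ∈ Finset.range N, q ^ (l + 1) * ∑ m ∈ Finset.range M, kernel (l + 1) m * c m := by
  rw [← sum_kernel_mul_pow, genPoly, Polynomial.eval_finsetSum, Finset.mul_sum,
    ← Finset.sum_neg_distrib]
  refine Finset.sum_congr rfl fun m _ => ?_
  have h : (∏ j ∈ Finset.range m, (1 + Polynomial.C (qInv j) * Polynomial.X)).eval (-qInt N) =
      kernel N m := by
    rw [Polynomial.eval_prod, kernel]
    refine Finset.prod_congr rfl fun j _ => ?_
    simp only [Polynomial.eval_add, Polynomial.eval_one, Polynomial.eval_mul, Polynomial.eval_C,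
      Polynomial.eval_X]
    ring
  rw [Polynomial.eval_mul, Polynomial.eval_mul, h, Polynomial.eval_C, Polynomial.eval_X]
  ring

/-- Subtracting the value at `0` removes the constant term of `w`, which the increments on the left
do not see. The bound `N ≤ M` makes the finite duality available for every summand `l < N`. -/
theorem genPoly_phi_eval (M N : ℕ) (hN : N ≤ M) (w : H1) :
    (genPoly M fun m => A (dq (phi w)) (m + 1) - A (dq (phi w)) m).eval (-qInt N) =
      dualStar w 0 - dualStar w N := by
  rw [genPoly_eval]
  induction w using word_induction with
  | hword u =>
    rw [dualStar, dualStar, extend_word, extend_word, phi, linExt_word]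
    simp only [A_dq_word]
    rcases u with _ | ⟨k, u⟩
    · simp [phiWord_nil, iterSum]
    · have h : ∀ m, iterSum zetaWeight 1 (phiWord (k :: u)) (m + 1) -
          iterSum zetaWeight 1 (phiWord (k :: u)) m = starTerm zetaWeight (phiWord (k :: u)) m := by
        intro m
        simp only [iterSum_one_eq_sum _ _ (phiWord_ne_nil k u), Finset.sum_range_succ,
          add_sub_cancel_left]
      simp only [h]
      rw [iterSum_cons_zero, zero_sub, iterSum]
      refine congrArg _ (Finset.sum_congr rfl fun l hl => ?_)
      rw [sum_kernel_starTerm k u M l (by rw [Finset.mem_range] at hl; omega), dualWeight,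
        mul_assoc]
  | hadd x y hx hy =>
    simp only [dualStar, map_add, A_add, add_sub_add_comm, mul_add, Finset.sum_add_distrib,
      neg_add] at hx hy ⊢
    rw [hx, hy]
  | hsmul c x hx =>
    simp only [dualStar, map_smul, LinearMap.map_smulₛₗ, A_smul, smul_eq_mul] at hx ⊢
    simp only [← mul_sub, ← hx, mul_neg, Finset.mul_sum]
    exact congrArg _ (Finset.sum_congr rfl fun l _ => Finset.sum_congr rfl fun m _ => by ring)

/-! ### Interpolation modulo `q^L` and the passage to the limit -/

/-- The summands with `m ≥ L` carry `q^(m+1)` and die, and the others have degree at most `m + 1 ≤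
L`. The bound does not depend on `M`. -/
theorem natDegree_map_genPoly_le {S : Type*} [CommRing S] (φ : R →+* S) (L M : ℕ)
    (hφ : φ (q ^ L) = 0) (c : ℕ → R) : ((genPoly M c).map φ).natDegree ≤ L := by
  rw [genPoly, Polynomial.map_sum]
  refine Polynomial.natDegree_sum_le_of_forall_le _ _ fun m _ => ?_
  rcases lt_or_ge m L with h | h
  · refine Polynomial.natDegree_map_le.trans ((Polynomial.natDegree_C_mul_le _ _).trans
      (Polynomial.natDegree_mul_le.trans ?_))
    have h1 : (∏ j ∈ Finset.range m, (1 + Polynomial.C (qInv j) * Polynomial.X)).natDegree ≤ m := by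
      refine (Polynomial.natDegree_prod_le _ _).trans ?_
      calc _ ≤ ∑ _j ∈ Finset.range m, 1 := Finset.sum_le_sum fun j _ => by compute_degree
        _ = m := by simp
    have h2 := Polynomial.natDegree_X_le (R := R)
    omega
  · obtain ⟨d, hd⟩ := Nat.exists_eq_add_of_le (show L ≤ m + 1 by omega)
    have hm : φ (q ^ (m + 1)) = 0 := by rw [hd, pow_add, map_mul, hφ, zero_mul]
    rw [Polynomial.map_mul, Polynomial.map_C, map_mul, map_mul, map_mul φ (q ^ (m + 1)), hm]
    simp

/-- A polynomial over a domain with roots at more distinct points than its degree modulo an ideal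
has all its coefficients in that ideal. -/
theorem map_eq_zero_of_eval_eq_zero {S T : Type*} [CommRing S] [IsDomain S] [CommRing T]
    (φ : S →+* T) (P : Polynomial S) (r : ℕ → S) (hr : Function.Injective r) (D : ℕ)
    (hP : ∀ N ≤ D, P.eval (r N) = 0) (hdeg : (P.map φ).natDegree ≤ D) : P.map φ = 0 := by
  by_cases hP0 : P = 0
  · simp [hP0]
  have hle : (Finset.range (D + 1)).val.map r ≤ P.roots := by
    rw [Multiset.le_iff_subset ((Finset.range (D + 1)).nodup.map hr)]
    intro x hx
    obtain ⟨N, hN, rfl⟩ := Multiset.mem_map.1 hx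
    rw [Polynomial.mem_roots hP0]
    exact hP N (Nat.lt_succ_iff.1 (Finset.mem_range.1 hN))
  obtain ⟨K, hK⟩ := (Multiset.prod_X_sub_C_dvd_iff_le_roots hP0 _).2 hle
  rw [Multiset.map_map] at hK
  change P = (∏ N ∈ Finset.range (D + 1), (Polynomial.X - Polynomial.C (r N))) * K at hK
  by_contra hne
  have : Nontrivial T := by
    by_contra hT
    rw [not_nontrivial_iff_subsingleton] at hT
    exact hne (Subsingleton.elim _ _)
  -- The target ring need not be a domain. The product of the `X - r N` is monic, so its image keeps
  -- degree `D + 1` and degrees add under multiplication by a nonzero factor.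
  have hmonic := Polynomial.monic_prod_X_sub_C r (Finset.range (D + 1))
  have hdegree := Polynomial.natDegree_finsetProd_X_sub_C_eq_card (Finset.range (D + 1)) r
  rw [Finset.card_range, ← hmonic.natDegree_map φ] at hdegree
  rw [hK, Polynomial.map_mul] at hne hdeg
  rw [(hmonic.map φ).natDegree_mul' (right_ne_zero_of_mul hne), hdegree] at hdeg
  omega

theorem dvd_zetaQ_sub_A (w : H1) (hw : w ∈ H0) (M : ℕ) : q ^ M ∣ zetaQ w - A w M := by
  have h := tendsto_zetaQ w hw
  let _ := qAdic
  rw [((Ideal.span {q}).hasBasis_nhds_adic _).tendsto_right_iff] at h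
  obtain ⟨n, ⟨y, hy, hn⟩, hM⟩ := ((h M trivial).and (Filter.eventually_ge_atTop M)).exists
  rw [Ideal.span_singleton_pow, SetLike.mem_coe, Ideal.mem_span_singleton] at hy
  have h1 : zetaQ w - A w M = (A w n - A w M) - y := by
    rw [← hn]
    ring
  rw [h1]
  exact dvd_sub (A_stable w hw M n hM) hy

/-- Modulo `q^L` each factor has degree at most `L`, so the whole has degree at most `2L`. The
cutoff `M = 2L` is just large enough to evaluate at the `2L + 1` points `-[0], …, -[2L]`. -/
theorem sum_coeff_dvd (w₁ w₂ : H1) (hw₁ : w₁ ∈ H1pos) (hw₂ : w₂ ∈ H1pos) (n L : ℕ) :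
    q ^ L ∣ (genPoly (2 * L) (fun m => A (dq (phi (harmonicMinus w₁ w₂))) (m + 1) -
        A (dq (phi (harmonicMinus w₁ w₂))) m) +
      genPoly (2 * L) (fun m => A (dq (phi w₁)) (m + 1) - A (dq (phi w₁)) m) *
        genPoly (2 * L) (fun m => A (dq (phi w₂)) (m + 1) - A (dq (phi w₂)) m)).coeff n := by
  have hφ : Ideal.Quotient.mk (Ideal.span {q ^ L}) (q ^ L) = 0 :=
    Ideal.Quotient.eq_zero_iff_mem.2 (Ideal.mem_span_singleton_self _)
  have h := map_eq_zero_of_eval_eq_zero (Ideal.Quotient.mk (Ideal.span {q ^ L}))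
    (genPoly (2 * L) (fun m => A (dq (phi (harmonicMinus w₁ w₂))) (m + 1) -
        A (dq (phi (harmonicMinus w₁ w₂))) m) +
      genPoly (2 * L) (fun m => A (dq (phi w₁)) (m + 1) - A (dq (phi w₁)) m) *
        genPoly (2 * L) (fun m => A (dq (phi w₂)) (m + 1) - A (dq (phi w₂)) m))
    (fun N => -qInt N) (fun _ _ h => qInt_injective (neg_injective h)) (2 * L)
    (fun N hN => by
      rw [Polynomial.eval_add, Polynomial.eval_mul, genPoly_phi_eval _ _ hN,
        genPoly_phi_eval _ _ hN, genPoly_phi_eval _ _ hN, dualStar_harmonicMinus,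
        dualStar_harmonicMinus, dualStar_zero_of_mem _ hw₁, dualStar_zero_of_mem _ hw₂]
      ring)
    (by
      have hd := natDegree_map_genPoly_le _ L (2 * L) hφ
      rw [Polynomial.map_add, Polynomial.map_mul]
      refine Polynomial.natDegree_add_le_of_degree_le ((hd _).trans (by omega))
        (Polynomial.natDegree_mul_le.trans ?_)
      rw [two_mul]
      exact add_le_add (by simpa only [two_mul] using hd _) (by simpa only [two_mul] using hd _))
  have h1 := congrArg (fun P => Polynomial.coeff P n) h
  simp only [Polynomial.coeff_map, Polynomial.coeff_zero] at h1
  rwa [Ideal.Quotient.eq_zero_iff_mem, Ideal.mem_span_singleton] at h1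

end QMZV

theorem mainTheorem3 (w₁ w₂ : QMZV.H1) (hw₁ : w₁ ∈ QMZV.H1pos) (hw₂ : w₂ ∈ QMZV.H1pos)
    (n : ℕ) (hn : 1 ≤ n) :
    QMZV.zetaQ (QMZV.circledast (QMZV.dq (QMZV.phi (QMZV.harmonicMinus w₁ w₂))) (QMZV.z 1 ^ n)) +
      ∑ kl ∈ (Finset.HasAntidiagonal.antidiagonal n).filter (fun kl => 1 ≤ kl.1 ∧ 1 ≤ kl.2),
        QMZV.zetaQ (QMZV.circledast (QMZV.dq (QMZV.phi w₁)) (QMZV.z 1 ^ kl.1)) *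
          QMZV.zetaQ (QMZV.circledast (QMZV.dq (QMZV.phi w₂)) (QMZV.z 1 ^ kl.2)) = 0 := by
  open QMZV in
  have key : ∀ L, q ^ L ∣ zetaQ (circledast (dq (phi (harmonicMinus w₁ w₂))) (z 1 ^ n)) +
      ∑ kl ∈ (Finset.HasAntidiagonal.antidiagonal n).filter (fun kl => 1 ≤ kl.1 ∧ 1 ≤ kl.2),
        zetaQ (circledast (dq (phi w₁)) (z 1 ^ kl.1)) *
          zetaQ (circledast (dq (phi w₂)) (z 1 ^ kl.2)) := by
    intro L
    have hcoeff : ∀ (x : H1) (k : ℕ), 1 ≤ k →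
        q ^ L ∣ zetaQ (circledast x (z 1 ^ k)) -
          (genPoly (2 * L) fun m => A x (m + 1) - A x m).coeff k := by
      intro x k hk
      obtain ⟨k, rfl⟩ := Nat.exists_eq_add_of_le' hk
      rw [genPoly_coeff_succ]
      exact (pow_dvd_pow q (by omega)).trans (dvd_zetaQ_sub_A _ (circledast_mem_H0 _ _) (2 * L))
    have h := sum_coeff_dvd w₁ w₂ hw₁ hw₂ n L
    -- `genPoly` has no constant term, so the Cauchy product reduces to the pairs with `k, l ≥ 1`.
    rw [Polynomial.coeff_add, Polynomial.coeff_mul, ← Finset.sum_filter_of_ne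
      (p := fun kl : ℕ × ℕ => 1 ≤ kl.1 ∧ 1 ≤ kl.2)] at h
    · refine (dvd_sub_left h).1 ?_
      rw [add_sub_add_comm, ← Finset.sum_sub_distrib]
      refine dvd_add (hcoeff _ _ hn) (Finset.dvd_sum fun kl hkl => ?_)
      have hkl := (Finset.mem_filter.1 hkl).2
      exact dvd_mul_sub_mul (hcoeff _ _ hkl.1) (hcoeff _ _ hkl.2)
    · intro kl _ hne
      constructor <;> refine Nat.one_le_iff_ne_zero.2 fun h0 => hne ?_ <;>
        rw [h0, genPoly_coeff_zero] <;> simp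
  ext m
  exact PowerSeries.X_pow_dvd_iff.1 (key (m + 1)) m (Nat.lt_succ_self m)
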